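/- Let $n\ge 1$, $A\in\mathbb R^{n\times n}$ and let $c\in\mathbb R^{1\times n}$ be a row vector. The observability operator $\mathcal O:\mathbb R^n\to\mathbb R^{\mathbb Z_{\ge 0}}$ is $(\mathcal O x_0)(t)=cA^tx_0$, $t\ge 0$, and for $t\ge1$ the matrix $\mathcal O^t\in\mathbb R^{t\times n}$ has the rows $c,cA,\dots,cA^{t-1}$. The pair $(A,c)$ is observable if $\mathcal O$ is injective (equivalently, if $\mathcal O^n$ is invertible). For a real vector or sequence $u\neq0$, let $S^-(u)\in\{0,1,2,\dots\}\cup\{\infty\}$ be the number of pairs of consecutive entries with negative product after all zeros of $u$ have been deleted, and put $S^-(0)=-1$. For any $u$, let $S^+(u)$ be the largest number (possibly $\infty$) of pairs of consecutive entries with negative product that can be obtained by replacing the zeros of $u$ by real numbers. For an integer $k\ge0$, a linear map $X$ between spaces of real vectors or sequences is strictly $k$-variation bounding if $S^+(Xu)\le k$ for all $u\ne0$ with $S^-(u)\le k$. For a real matrix $X$, its $r$-th multiplicative compound $X_{[r]}$ is the matrix of all $r\times r$ minors of $X$, the $r$-element sets of row and of column indices being ordered lexicographically. A system $(\tilde A,\tilde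 b,\tilde c)$, with $\tilde A$ square, $\tilde b$ a column and $\tilde c$ a row, is strictly externally positive if $\tilde c\tilde A^{t-1}\tilde b>0$ for all integers $t\ge1$. **Theorem.** Let $(A,c)$ be observable. Then $\mathcal O$ is strictly $(n-1)$-variation bounding if and only if, for every $r\in\{1,\dots,n\}$, the system $(\tilde A_r,\tilde b_r,\tilde c_r)$ is strictly externally positive, where $$\tilde A_r=A_{[r]},\qquad \tilde b_r=\left(A^{n-r}(\mathcal O^n)^{-1}\begin{pmatrix}0\\ I_r\end{pmatrix}\right)_{[r]},\qquad \tilde c_r=(\mathcal O^r)_{[r]},$$ and $\begin{pmatrix}0\\ I_r\end{pmatrix}\in\mathbb R^{n\times r}$ has an $(n-r)\times r$ zero block above the identity matrix $I_r$. -/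

import Mathlib

open scoped Matrix

namespace VarBound

/-- Number of pairs of consecutive entries of `u` whose product is negative. The index type `ι` is
meant to be `Fin m` (vectors), `ℕ` (sequences), or a subset of one of these with the induced order;
`i ⋖ j` says that `j` is the immediate successor of `i`. The value may be `⊤` for sequences. -/
noncomputable def adjSignChanges {ι : Type*} [LinearOrder ι] (u : ι → ℝ) : ℕ∞ :=
  {p : ι × ι | p.1 ⋖ p.2 ∧ u p.1 * u p.2 < 0}.encard

open Classical in
/-- The variation `S⁻(u)`: delete all zeros of `u`, then count sign changes; `S⁻(0) = -1`. -/
noncomputable def variMinus {ι : Type*} [LinearOrder ι] (u : ι → ℝ) : EReal :=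
  if u = 0 then -1
  else (((adjSignChanges (fun i : {i : ι // u i ≠ 0} => u i) : ℕ∞) : ENNReal) : EReal)

/-- The variation `S⁺(u)`: the largest number of sign changes that can be obtained by replacing
the zeros of `u` by arbitrary real numbers. -/
noncomputable def variPlus {ι : Type*} [LinearOrder ι] (u : ι → ℝ) : ℕ∞ :=
  ⨆ v ∈ {v : ι → ℝ | ∀ i, u i ≠ 0 → v i = u i}, adjSignChanges v

/-- Strictly `k`-variation bounding linear maps (between spaces of vectors or sequences). -/
def StrictlyVariationBounding {ι κ : Type*} [LinearOrder ι] [LinearOrder κ] (k : ℕ)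
    (X : (ι → ℝ) →ₗ[ℝ] (κ → ℝ)) : Prop :=
  ∀ u : ι → ℝ, u ≠ 0 → variMinus u ≤ (k : EReal) → variPlus (X u) ≤ (k : ℕ∞)

/-- The `r`-th multiplicative compound matrix. Its rows and columns are indexed by the `r`-element
subsets `I`, `J` of the row and column indices, and its entries are the minors `det X_{I,J}`, the
elements of `I` and `J` being taken in increasing order. -/
def compound {m n : ℕ} (X : Matrix (Fin m) (Fin n) ℝ) (r : ℕ) :
    Matrix (Set.powersetCard (Fin m) r) (Set.powersetCard (Fin n) r) ℝ :=
  Matrix.of fun I J =>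
    (X.submatrix (Finset.orderEmbOfFin I.1 I.2) (Finset.orderEmbOfFin J.1 J.2)).det

/-- The unique `r`-element subset of the `r` indices `Fin r`: the only row (column) index of the
`r`-th compound of a matrix with `r` rows (columns). -/
def fullIndex (r : ℕ) : Set.powersetCard (Fin r) r := ⟨Finset.univ, Finset.card_fin r⟩

/-- The observability operator `x₀ ↦ (c Aᵗ x₀)_{t ≥ 0}`. -/
def obsOperator {n : ℕ} (A : Matrix (Fin n) (Fin n) ℝ) (c : Fin n → ℝ) :
    (Fin n → ℝ) →ₗ[ℝ] (ℕ → ℝ) where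
  toFun x t := c ⬝ᵥ (A ^ t *ᵥ x)
  map_add' x y := by
    funext t
    simp [Matrix.mulVec_add, dotProduct_add]
  map_smul' a x := by
    funext t
    simp [Matrix.mulVec_smul, dotProduct_smul]

/-- `(A, c)` is observable: the initial state is determined by the output it generates. -/
def Observable {n : ℕ} (A : Matrix (Fin n) (Fin n) ℝ) (c : Fin n → ℝ) : Prop :=
  Function.Injective (obsOperator A c)

/-- The truncated observability matrix `𝒪ᵗ`, with rows `c, cA, …, cA^{t-1}`. -/
def obsMatrix {n : ℕ} (A : Matrix (Fin n) (Fin n) ℝ) (c : Fin n → ℝ) (t : ℕ) :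
    Matrix (Fin t) (Fin n) ℝ :=
  Matrix.of fun i => c ᵥ* A ^ (i : ℕ)

/-- The `n × r` block matrix with an `(n-r) × r` zero block above the identity `I_r` (`r ≤ n`). -/
def zeroOverOne (n r : ℕ) : Matrix (Fin n) (Fin r) ℝ :=
  Matrix.of fun i j => if (i : ℕ) + r = n + (j : ℕ) then 1 else 0

/-- The system `(A, b, c)` with finite state index set `ι` is strictly externally positive: its
impulse response `g(t) = c A^{t-1} b`, `t ≥ 1`, is strictly positive. -/
def StrictlyExternallyPositive {ι : Type*} [Fintype ι] [DecidableEq ι]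
    (A : Matrix ι ι ℝ) (b c : ι → ℝ) : Prop :=
  ∀ t : ℕ, 1 ≤ t → 0 < c ⬝ᵥ (A ^ (t - 1) *ᵥ b)

/-- `c̃_r = (𝒪^r)_[r]`, a single row. -/
def cTilde {n : ℕ} (A : Matrix (Fin n) (Fin n) ℝ) (c : Fin n → ℝ) (r : ℕ) :
    Set.powersetCard (Fin n) r → ℝ :=
  fun J => compound (obsMatrix A c r) r (fullIndex r) J

/-- `b̃_r = (A^{n-r} (𝒪^n)⁻¹ [0; I_r])_[r]` for `r ≤ n`, a single column. -/
noncomputable def bTilde {n : ℕ} (A : Matrix (Fin n) (Fin n) ℝ) (c : Fin n → ℝ) (r : ℕ) :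
    Set.powersetCard (Fin n) r → ℝ :=
  fun I => compound (A ^ (n - r) * (obsMatrix A c n)⁻¹ * zeroOverOne n r) r I (fullIndex r)

end VarBound

open VarBound

/-!
Every vector of `ℝⁿ` has variation at most `n - 1`, so the left-hand side says that no nonzero
output `𝒪 x` has `n` weak sign changes. In the coordinates given by the first `n` outputs, `𝒪` is
the matrix `M = outputMatrix A c` with infinitely many rows `c Aᵗ (𝒪ⁿ)⁻¹`, the first `n` of which
form the identity.

By the Gantmacher–Krein principle the left-hand side is equivalent to positivity of all `n × n`
minors of `M`. The link is the expansion `sum_alternating_mul_minor`, in which the entries of `M x`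
in `n + 1` rows, with alternating signs, are weighted by the minors omitting one of these rows. It
shows that positive minors exclude `n` weak sign changes (`variPlus_mulVec_le`), and that without
such outputs the minors omitting one of `n + 1` given rows have the same strict sign
(`minor_mul_minor_pos`); starting from the identity block, this sign is positive.

By the Cauchy–Binet formula, the impulse response of the `r`-th compound system consists of the
`r × r` minors of `M` in its last `r` columns and `r` consecutive rows from `s ≥ n - r` on, which
are also the `n × n` minors of `M` with rows `0, …, n - r - 1, s, …, s + r - 1`
(`impulseResponse_eq_minor`). So the right-hand side asserts that just these minors are positive.
Fekete's argument with the three-term Plücker relation shows that this implies positivity of all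
the minors (`posMinor_of_initial`).
-/

namespace VarBound

/-! ### Compound matrices and the Cauchy–Binet formula -/

/-- The **Cauchy–Binet formula**. Expanding `det (X * Y)` by multilinearity in the rows gives a sum
over all maps `p : Fin r → Fin n`; the non-injective ones contribute zero, and the injective ones
are the increasing enumerations of the `r`-element sets composed with permutations. -/
theorem det_mul_eq_sum_powersetCard {r n : ℕ} (X : Matrix (Fin r) (Fin n) ℝ)
    (Y : Matrix (Fin n) (Fin r) ℝ) :
    (X * Y).det = ∑ J : Set.powersetCard (Fin n) r,
      (X.submatrix id (Finset.orderEmbOfFin J.1 J.2)).det *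
        (Y.submatrix (Finset.orderEmbOfFin J.1 J.2) id).det := by
  have hrow : (X * Y).det =
      ∑ p : Fin r → Fin n, (∏ i, X i (p i)) * (Y.submatrix p id).det := by
    have h := (Matrix.detRowAlternating (n := Fin r) (R := ℝ)).toMultilinearMap.map_sum
      (fun i (k : Fin n) => X i k • Y k)
    have h2 : (fun i => ∑ k, X i k • Y k) = X * Y := by
      ext i j
      simp [Matrix.mul_apply, Finset.sum_apply]
    rw [h2] at h
    refine h.trans (Finset.sum_congr rfl fun p _ => ?_)
    rw [MultilinearMap.map_smul_univ]
    rfl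
  have hsum : ∀ J : Set.powersetCard (Fin n) r,
      (X.submatrix id (Finset.orderEmbOfFin J.1 J.2)).det *
        (Y.submatrix (Finset.orderEmbOfFin J.1 J.2) id).det =
      ∑ σ : Equiv.Perm (Fin r), (∏ i, X i (Finset.orderEmbOfFin J.1 J.2 (σ i))) *
        (Y.submatrix (fun i => Finset.orderEmbOfFin J.1 J.2 (σ i)) id).det := by
    intro J
    generalize (⇑(Finset.orderEmbOfFin J.1 J.2) : Fin r → Fin n) = e
    rw [← Matrix.det_transpose, Matrix.det_apply', Finset.sum_mul]
    refine Finset.sum_congr rfl fun σ _ => ?_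
    have hperm : (Y.submatrix (fun i => e (σ i)) id).det =
        (Equiv.Perm.sign σ : ℤ) * (Y.submatrix e id).det :=
      Matrix.det_permute σ (Y.submatrix e id)
    rw [hperm]
    simp only [Matrix.transpose_apply, Matrix.submatrix_apply, id]
    ring
  rw [hrow, Finset.sum_congr rfl fun J _ => hsum J, ← Fintype.sum_prod_type']
  symm
  refine Fintype.sum_of_injective
    (fun q : Set.powersetCard (Fin n) r × Equiv.Perm (Fin r) =>
      fun i => Finset.orderEmbOfFin q.1.1 q.1.2 (q.2 i)) ?_ _ _ ?_ fun _ => rfl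
  · rintro ⟨J, σ⟩ ⟨K, τ⟩ h
    have hr : ∀ q : Set.powersetCard (Fin n) r × Equiv.Perm (Fin r),
        Set.range (fun i => Finset.orderEmbOfFin q.1.1 q.1.2 (q.2 i)) = q.1.1 := by
      intro q
      rw [← Finset.range_orderEmbOfFin q.1.1 q.1.2]
      exact q.2.surjective.range_comp (Finset.orderEmbOfFin q.1.1 q.1.2)
    have hJK : J = K := by
      apply Subtype.ext
      apply Finset.coe_injective
      rw [← hr (J, σ), ← hr (K, τ)]
      exact congrArg Set.range h
    subst hJK
    congr 1
    ext i : 1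
    exact (Finset.orderEmbOfFin J.1 J.2).injective (congrFun h i)
  · intro p hp
    by_cases hinj : Function.Injective p
    · refine absurd ?_ hp
      set J : Finset (Fin n) := Finset.univ.image p with hJ
      have hcard : J.card = r := by
        rw [hJ, Finset.card_image_of_injective _ hinj, Finset.card_fin]
      have hmem : ∀ i, ∃ j, Finset.orderEmbOfFin J hcard j = p i := by
        intro i
        have : p i ∈ Set.range (Finset.orderEmbOfFin J hcard) := by
          rw [Finset.range_orderEmbOfFin]; simp [hJ]
        exact this
      choose σ hσ using hmem
      have hσi : Function.Injective σ := by
        intro i j hij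
        apply hinj
        rw [← hσ i, ← hσ j, hij]
      exact ⟨(⟨J, hcard⟩, Equiv.ofBijective σ (Finite.injective_iff_bijective.1 hσi)),
        funext fun i => hσ i⟩
    · simp only [Function.Injective, not_forall] at hinj
      obtain ⟨i, j, hij, hne⟩ := hinj
      rw [Matrix.det_zero_of_row_eq hne, mul_zero]
      ext k
      simp [hij]

theorem compound_mul {l m n : ℕ} (X : Matrix (Fin l) (Fin m) ℝ) (Y : Matrix (Fin m) (Fin n) ℝ)
    (r : ℕ) : compound (X * Y) r = compound X r * compound Y r := by
  ext I J
  simp only [compound, Matrix.of_apply, Matrix.mul_apply]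
  rw [Matrix.submatrix_mul _ _ _ id _ Function.bijective_id, det_mul_eq_sum_powersetCard]
  rfl

theorem compound_pow_mul {m n : ℕ} (A : Matrix (Fin m) (Fin m) ℝ) (B : Matrix (Fin m) (Fin n) ℝ)
    (r t : ℕ) : compound A r ^ t * compound B r = compound (A ^ t * B) r := by
  induction t with
  | zero => simp
  | succ t ih => rw [pow_succ', Matrix.mul_assoc, ih, ← compound_mul, pow_succ', Matrix.mul_assoc]

theorem compound_fullIndex {r : ℕ} (X : Matrix (Fin r) (Fin r) ℝ) :
    compound X r (fullIndex r) (fullIndex r) = X.det := by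
  have h : ⇑(Finset.orderEmbOfFin (fullIndex r).1 (fullIndex r).2) = id :=
    (Finset.orderEmbOfFin_unique (s := Finset.univ) (Finset.card_fin r) (fun _ => Finset.mem_univ _)
      strictMono_id).symm
  simp [compound, h]

/-- By multiplicativity of compounds, the impulse response of the `r`-th compound system is a
sequence of `r × r` determinants. -/
theorem cTilde_dotProduct_pow_mulVec_bTilde {n : ℕ} (A : Matrix (Fin n) (Fin n) ℝ) (c : Fin n → ℝ)
    (r t : ℕ) :
    cTilde A c r ⬝ᵥ (compound A r ^ t *ᵥ bTilde A c r) =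
      (obsMatrix A c r *
        (A ^ t * (A ^ (n - r) * (obsMatrix A c n)⁻¹ * zeroOverOne n r))).det := by
  rw [← compound_fullIndex, compound_mul, ← compound_pow_mul]
  rfl

/-! ### Fekete's criterion for positive maximal minors -/

/-- The three-term Plücker relation among the maximal minors of `m + 2` rows of which `m` are
fixed, solved for the product that contains the nonzero minor `D a c`. Modulo the span of the fixed
rows everything happens in the plane spanned by `a` and `c`. -/
theorem det_mul_det_eq_of_det_ne_zero {m : ℕ} (s : Fin m → Fin (m + 2) → ℝ)
    (D : (Fin (m + 2) → ℝ) → (Fin (m + 2) → ℝ) → ℝ)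
    (hD : ∀ x y, D x y = Matrix.det (Matrix.of (Matrix.vecCons x (Matrix.vecCons y s))))
    (a b c d : Fin (m + 2) → ℝ) (hac : D a c ≠ 0) :
    D a c * D b d = D a b * D c d + D a d * D b c := by
  let F := Matrix.detRowAlternating (n := Fin (m + 2)) (R := ℝ)
  have hF : ∀ x y, D x y = F.curryLeft x (Matrix.vecCons y s) := hD
  have hF' : ∀ x y, D x y = (F.curryLeft x).curryLeft y s := hD
  have hadd₁ : ∀ x x' y, D (x + x') y = D x y + D x' y := by
    intro x x' y; simp only [hF, map_add, AlternatingMap.add_apply]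
  have hsmul₁ : ∀ (k : ℝ) x y, D (k • x) y = k * D x y := by
    intro k x y; simp only [hF, map_smul, AlternatingMap.smul_apply, smul_eq_mul]
  have hadd₂ : ∀ x y y', D x (y + y') = D x y + D x y' := by
    intro x x' y; simp only [hF', map_add, AlternatingMap.add_apply]
  have hsmul₂ : ∀ (k : ℝ) x y, D x (k • y) = k * D x y := by
    intro k x y; simp only [hF', map_smul, AlternatingMap.smul_apply, smul_eq_mul]
  have hself : ∀ x, D x x = 0 := by
    intro x
    rw [hF', AlternatingMap.curryLeft_same]
    rfl
  have hswap : ∀ x y, D y x = - D x y := by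
    intro x y
    have h := hself (x + y)
    simp only [hadd₁, hadd₂, hself] at h
    linarith
  have hs₂ : ∀ x, ∀ z ∈ Submodule.span ℝ (Set.range s), D x z = 0 := by
    intro x z hz
    induction hz using Submodule.span_induction with
    | mem z hz =>
      obtain ⟨i, rfl⟩ := hz
      rw [hD]
      refine Matrix.det_zero_of_row_eq (i := 1) (j := i.succ.succ) (by simp [Fin.ext_iff]) ?_
      ext k; simp
    | zero => simpa using hsmul₂ 0 x 0
    | add z w _ _ hz hw => rw [hadd₂, hz, hw, add_zero]
    | smul k z _ hz => rw [hsmul₂, hz, mul_zero]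
  have hs₁ : ∀ x, ∀ z ∈ Submodule.span ℝ (Set.range s), D z x = 0 := by
    intro x z hz
    rw [hswap, hs₂ x z hz, neg_zero]
  have hspan : ∀ x, ∃ k l : ℝ, ∃ z ∈ Submodule.span ℝ (Set.range s), x = k • a + (l • c + z) := by
    intro x
    have hli : LinearIndependent ℝ (Matrix.vecCons a (Matrix.vecCons c s)) := by
      have := Matrix.linearIndependent_rows_iff_isUnit
        (A := Matrix.of (Matrix.vecCons a (Matrix.vecCons c s)))
      refine this.2 ?_
      rw [Matrix.isUnit_iff_isUnit_det, ← hD]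
      exact isUnit_iff_ne_zero.2 hac
    have htop := hli.span_eq_top_of_card_eq_finrank (by simp)
    have hx : x ∈ Submodule.span ℝ (Set.range (Matrix.vecCons a (Matrix.vecCons c s))) := by
      rw [htop]; trivial
    rw [Matrix.range_cons, Matrix.range_cons, Set.singleton_union, Set.singleton_union,
      Submodule.mem_span_insert] at hx
    obtain ⟨k, y, hy, rfl⟩ := hx
    rw [Submodule.mem_span_insert] at hy
    obtain ⟨l, z, hz, rfl⟩ := hy
    exact ⟨k, l, z, hz, rfl⟩
  obtain ⟨k, l, z, hz, rfl⟩ := hspan b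
  obtain ⟨k', l', z', hz', rfl⟩ := hspan d
  simp only [hadd₁, hadd₂, hsmul₁, hsmul₂, hs₁ _ z hz, hs₂ _ z hz, hs₂ _ z' hz',
    hself, hswap a c]
  ring

/-- The minor of `W` with row sequence `f`, multiplied by the Vandermonde determinant of `f`. Both
factors are alternating in `f`, so the product depends only on the set of values of `f`, and its
sign is the sign of the minor with its rows in increasing order. This avoids tracking the signs of
sorting permutations. -/
noncomputable def orientedMinor {n : ℕ} (W : Matrix ℕ (Fin n) ℝ) (f : Fin n → ℕ) : ℝ :=
  (W.submatrix f id).det * (Matrix.vandermonde fun i => (f i : ℝ)).det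

theorem orientedMinor_comp_perm {n : ℕ} (W : Matrix ℕ (Fin n) ℝ) (f : Fin n → ℕ)
    (σ : Equiv.Perm (Fin n)) : orientedMinor W (f ∘ σ) = orientedMinor W f := by
  have h₁ := Matrix.det_permute σ (W.submatrix f id)
  have h₂ := Matrix.det_permute σ (Matrix.vandermonde fun i => (f i : ℝ))
  rw [Matrix.submatrix_submatrix] at h₁
  have h₃ : (Matrix.vandermonde fun i => (f i : ℝ)).submatrix σ id =
      Matrix.vandermonde fun i => ((f ∘ σ) i : ℝ) := rfl
  rw [h₃] at h₂
  rw [orientedMinor, orientedMinor, h₂]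
  have h₄ : W.submatrix (f ∘ σ) id = W.submatrix (f ∘ σ) (id ∘ id) := rfl
  rw [h₄, h₁]
  have h₅ : ((Equiv.Perm.sign σ : ℤ) : ℝ) * ((Equiv.Perm.sign σ : ℤ) : ℝ) = 1 := by
    rw [← Int.cast_mul, ← Units.val_mul, Int.units_mul_self]; simp
  linear_combination ((W.submatrix f id).det *
    (Matrix.vandermonde fun i => (f i : ℝ)).det) * h₅

theorem det_vandermonde_pos_of_strictMono {n : ℕ} {f : Fin n → ℕ} (hf : StrictMono f) :
    0 < (Matrix.vandermonde fun i => (f i : ℝ)).det := by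
  rw [Matrix.det_vandermonde]
  refine Finset.prod_pos fun i _ => Finset.prod_pos fun j hj => ?_
  have := hf (Finset.mem_Ioi.1 hj)
  exact sub_pos.2 (by exact_mod_cast this)

theorem orientedMinor_pos_iff {n : ℕ} (W : Matrix ℕ (Fin n) ℝ) {f : Fin n → ℕ}
    (hf : StrictMono f) : 0 < orientedMinor W f ↔ 0 < (W.submatrix f id).det :=
  mul_pos_iff_of_pos_right (det_vandermonde_pos_of_strictMono hf)

/-- The maximal minor of `W` with row set `I` (rows in increasing order) is positive. -/
def PosMinor {n : ℕ} (W : Matrix ℕ (Fin n) ℝ) (I : Finset ℕ) : Prop :=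
  ∃ f : Fin n → ℕ, StrictMono f ∧ Set.range f = I ∧ 0 < (W.submatrix f id).det

theorem posMinor_iff {n : ℕ} (W : Matrix ℕ (Fin n) ℝ) {I : Finset ℕ} {f : Fin n → ℕ}
    (hf : Function.Injective f) (hI : Set.range f = I) : PosMinor W I ↔ 0 < orientedMinor W f := by
  have key : ∀ g : Fin n → ℕ, Set.range g = I → orientedMinor W f = orientedMinor W g := by
    intro g hgI
    have hmem : ∀ i, ∃ j, g j = f i := by
      intro i
      have : f i ∈ Set.range g := by rw [hgI, ← hI]; exact ⟨i, rfl⟩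
      exact this
    choose σ hσ using hmem
    have hσi : Function.Injective σ := by
      intro i j hij
      apply hf
      rw [← hσ i, ← hσ j, hij]
    have : f = g ∘ Equiv.ofBijective σ (Finite.injective_iff_bijective.1 hσi) :=
      funext fun i => (hσ i).symm
    rw [this, orientedMinor_comp_perm]
  constructor
  · rintro ⟨g, hg, hgI, hpos⟩
    rw [key g hgI]
    exact (orientedMinor_pos_iff W hg).2 hpos
  · intro h
    have hcard : I.card = n := by
      have hI' : I = Finset.univ.image f := by
        apply Finset.coe_injective; simp [hI]
      rw [hI', Finset.card_image_of_injective _ hf, Finset.card_fin]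
    have hr := Finset.range_orderEmbOfFin I hcard
    have hm := (Finset.orderEmbOfFin I hcard).strictMono
    exact ⟨_, hm, hr, (orientedMinor_pos_iff W hm).1 (key _ hr ▸ h)⟩

/-- The exchange step of Fekete's argument. For `a < p < q < r`, the Plücker relation expresses the
product of the minors for `{a, q}` and `{p, r}` (each joined with `S`) as the sum of the products for
`{a, p}`, `{q, r}` and for `{a, r}`, `{p, q}`. The Vandermonde factors of the three products differ
only by positive factors, so positivity of five of the minors implies positivity of the sixth. -/
theorem posMinor_of_plucker {n : ℕ} (W : Matrix ℕ (Fin n) ℝ) (S : Finset ℕ)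
    (hS : S.card + 2 = n) {a p q r : ℕ} (hap : a < p) (hpq : p < q) (hqr : q < r)
    (ha : a ∉ S) (hp : p ∉ S) (hq : q ∉ S) (hr : r ∉ S)
    (h₁ : PosMinor W (insert a (insert p S))) (h₂ : PosMinor W (insert a (insert q S)))
    (h₃ : PosMinor W (insert a (insert r S))) (h₄ : PosMinor W (insert p (insert q S)))
    (h₅ : PosMinor W (insert q (insert r S))) : PosMinor W (insert p (insert r S)) := by
  subst hS
  set s : Fin S.card → ℕ := ⇑(S.orderEmbOfFin rfl) with hs
  have hsr : Set.range s = S := Finset.range_orderEmbOfFin S rfl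
  have hsm : ∀ i, s i ∈ S := fun i => Finset.orderEmbOfFin_mem S rfl i
  have hsi : Function.Injective s := (S.orderEmbOfFin rfl).injective
  set D : ℕ → ℕ → ℝ := fun x y =>
    Matrix.det (Matrix.of (Matrix.vecCons (W x) (Matrix.vecCons (W y) fun i => W (s i)))) with hD
  -- The Vandermonde determinant for `x, y` followed by `s` is `(y - x) * h x * h y * V`.
  set h : ℕ → ℝ := fun x => ∏ i, ((s i : ℝ) - x) with hh
  set V : ℝ := (Matrix.vandermonde fun i => (s i : ℝ)).det with hV
  have hiff : ∀ x y, x ≠ y → x ∉ S → y ∉ S →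
      (PosMinor W (insert x (insert y S)) ↔ 0 < D x y * ((y - x) * h x * h y * V)) := by
    intro x y hxy hx hy
    rw [posMinor_iff W (f := Matrix.vecCons x (Matrix.vecCons y s))]
    · have e₁ : W.submatrix (Matrix.vecCons x (Matrix.vecCons y s)) id =
          Matrix.of (Matrix.vecCons (W x) (Matrix.vecCons (W y) fun i => W (s i))) := by
        ext i j
        refine Fin.cases ?_ (fun i => ?_) i
        · rfl
        · refine Fin.cases ?_ (fun i => ?_) i <;> rfl
      have e₂ : (Matrix.vandermonde fun i =>
          ((Matrix.vecCons x (Matrix.vecCons y s) : Fin (S.card + 2) → ℕ) i : ℝ)).det =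
          (y - x) * h x * h y * V := by
        rw [Matrix.det_vandermonde, Fin.prod_univ_succ, Fin.prod_univ_succ, hV,
          Matrix.det_vandermonde]
        simp only [Fin.prod_Ioi_zero, Fin.prod_Ioi_succ, Fin.prod_univ_succ, Matrix.cons_val_zero,
          Matrix.cons_val_succ, hh]
        ring
      rw [orientedMinor, e₁, e₂]
    · intro i j
      refine Fin.cases ?_ (fun i => ?_) i <;> refine Fin.cases ?_ (fun j => ?_) j
      · simp
      · refine Fin.cases ?_ (fun j => ?_) j
        · simp [hxy]
        · intro he; exact absurd (hsm j) (by simp at he; rwa [← he])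
      · refine Fin.cases ?_ (fun i => ?_) i
        · simp [hxy.symm]
        · intro he; exact absurd (hsm i) (by simp at he; rwa [he])
      · refine Fin.cases ?_ (fun i => ?_) i <;> refine Fin.cases ?_ (fun j => ?_) j
        · simp
        · intro he; exact absurd (hsm j) (by simp at he; rwa [← he])
        · intro he; exact absurd (hsm i) (by simp at he; rwa [he])
        · intro he
          have : s i = s j := by simpa using he
          rw [hsi this]
    · rw [Matrix.range_cons, Matrix.range_cons, hsr]
      ext; simp [or_left_comm]
  have haq := hap.trans hpq
  have hpr := hpq.trans hqr
  have har := hap.trans hpr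
  rw [hiff _ _ hap.ne ha hp] at h₁
  rw [hiff _ _ haq.ne ha hq] at h₂
  rw [hiff _ _ har.ne ha hr] at h₃
  rw [hiff _ _ hpq.ne hp hq] at h₄
  rw [hiff _ _ hqr.ne hq hr] at h₅
  rw [hiff _ _ hpr.ne hp hr]
  have hplu : D a q * D p r = D a p * D q r + D a r * D p q :=
    det_mul_det_eq_of_det_ne_zero (fun i => W (s i)) _ (fun _ _ => rfl) (W a) (W p) (W q) (W r)
      (left_ne_zero_of_mul h₂.ne')
  have key : ∀ {x y : ℕ}, x < y → 0 < D x y * (((y : ℝ) - x) * h x * h y * V) →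
      0 < D x y * (h x * h y * V) := by
    intro x y hxy hpos
    have hlt : (0 : ℝ) < (y : ℝ) - x := sub_pos.2 (by exact_mod_cast hxy)
    refine (mul_pos_iff_of_pos_left hlt).1 ?_
    linarith
  replace h₁ := key hap h₁
  replace h₂ := key haq h₂
  replace h₃ := key har h₃
  replace h₄ := key hpq h₄
  replace h₅ := key hqr h₅
  suffices hpos : 0 < D p r * (h p * h r * V) by
    have hlt : (0 : ℝ) < (r : ℝ) - p := sub_pos.2 (by exact_mod_cast hpr)
    have := mul_pos hlt hpos
    linarith
  refine (mul_pos_iff_of_pos_left h₂).1 ?_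
  have := add_pos (mul_pos h₁ h₅) (mul_pos h₃ h₄)
  have e : D a q * (h a * h q * V) * (D p r * (h p * h r * V)) =
      D a p * (h a * h p * V) * (D q r * (h q * h r * V)) +
        D a r * (h a * h r * V) * (D p q * (h p * h q * V)) := by
    linear_combination (h a * h q * V * (h p * h r * V)) * hplu
  rw [e]; exact this

/-- **Fekete's criterion** for the maximal minors of a matrix with infinitely many rows: all of
them are positive as soon as those are whose row set is an initial segment followed by an
interval. The outer induction is downward on the length `k` of an initial segment contained in `I`,
the inner one on the length `d` of an interval containing the rest of `I`. A row `m` missing from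
that interval, together with the pivot row `k`, permits an exchange step that either lengthens the
initial segment or shortens the interval. -/
theorem posMinor_of_initial {n : ℕ} (W : Matrix ℕ (Fin n) ℝ) (hn : 1 ≤ n)
    (H : ∀ k s, k < n → k ≤ s → PosMinor W (Finset.range k ∪ Finset.Ico s (s + (n - k))))
    (I : Finset ℕ) (hI : I.card = n) : PosMinor W I := by
  suffices h : ∀ j, j ≤ n → ∀ I : Finset ℕ, I.card = n → Finset.range (n - j) ⊆ I →
      PosMinor W I from h n le_rfl I hI (by simp)
  intro j
  induction j with
  | zero =>
    intro _ I hI hsub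
    have hIr : Finset.range n = I := Finset.eq_of_subset_of_card_le hsub (by simp [hI])
    have := H 0 0 hn le_rfl
    rwa [Finset.range_zero, Finset.empty_union, zero_add, tsub_zero, ← Finset.range_eq_Ico,
      hIr] at this
  | succ j ih =>
    intro hj
    obtain ⟨k, hk⟩ : ∃ k, n - (j + 1) = k := ⟨_, rfl⟩
    have hk' : n - j = k + 1 := by omega
    rw [hk]
    replace ih := ih (by omega)
    rw [hk'] at ih
    have hstep : ∀ d a : ℕ, k < a → ∀ I : Finset ℕ, I.card = n → Finset.range k ⊆ I →
        I ⊆ Finset.range k ∪ Finset.Ico a (a + d) → PosMinor W I := by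
      intro d
      induction d with
      | zero =>
        intro a _ I hI _ hsub
        have := Finset.card_le_card hsub
        simp at this
        omega
      | succ d ihd =>
        intro a hka I hI hkI hsub
        have hsub' : ∀ x ∈ I, x < k ∨ (a ≤ x ∧ x < a + (d + 1)) := by
          intro x hx; simpa using hsub hx
        have hkI' : ∀ x, x < k → x ∈ I := fun x hx => hkI (Finset.mem_range.2 hx)
        by_cases ha : a ∈ I
        swap
        · refine ihd (a + 1) (by omega) I hI hkI fun x hx => ?_
          have := hsub' x hx
          have : x ≠ a := fun h => ha (h ▸ hx)
          simp only [Finset.mem_union, Finset.mem_range, Finset.mem_Ico]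
          omega
        by_cases hb : a + d ∈ I
        swap
        · refine ihd a hka I hI hkI fun x hx => ?_
          have := hsub' x hx
          have : x ≠ a + d := fun h => hb (h ▸ hx)
          simp only [Finset.mem_union, Finset.mem_range, Finset.mem_Ico]
          omega
        by_cases hfull : ∀ m, a ≤ m → m < a + (d + 1) → m ∈ I
        · have hIeq : I = Finset.range k ∪ Finset.Ico a (a + (d + 1)) := by
            refine hsub.antisymm fun x hx => ?_
            simp only [Finset.mem_union, Finset.mem_range, Finset.mem_Ico] at hx
            rcases hx with hx | hx
            · exact hkI' x hx
            · exact hfull x hx.1 hx.2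
          have hcard : k + (d + 1) = n := by
            rw [hIeq, Finset.card_union_of_disjoint] at hI
            · simpa using hI
            · rw [Finset.disjoint_left]
              intro x hx hx'
              simp only [Finset.mem_range, Finset.mem_Ico] at hx hx'
              omega
          have := H k a (by omega) hka.le
          rwa [show n - k = d + 1 by omega, ← hIeq] at this
        · push Not at hfull
          obtain ⟨m, ham, hmb, hmI⟩ := hfull
          have hma : m ≠ a := fun h => hmI (h ▸ ha)
          have hmd : m ≠ a + d := fun h => hmI (h ▸ hb)
          have hkn : k ∉ I := fun h => by have := hsub' k h; omega
          set S := (I.erase a).erase (a + d) with hS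
          have hb' : a + d ∈ I.erase a := Finset.mem_erase.2 ⟨by omega, hb⟩
          have hcardS : S.card + 2 = n := by
            rw [hS]
            have h₁ := Finset.card_erase_add_one hb'
            have h₂ := Finset.card_erase_add_one ha
            omega
          have hmS : ∀ x, x ∈ S ↔ x ≠ a + d ∧ x ≠ a ∧ x ∈ I := by
            intro x; simp [hS, Finset.mem_erase]
          have hIS : I = insert a (insert (a + d) S) := by
            rw [hS, Finset.insert_erase hb', Finset.insert_erase ha]
          have hkS : k ∉ S := fun h => hkn ((hmS k).1 h).2.2
          have haS : a ∉ S := fun h => ((hmS a).1 h).2.1 rfl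
          have hbS : a + d ∉ S := fun h => ((hmS _).1 h).1 rfl
          have hmmS : m ∉ S := fun h => hmI ((hmS m).1 h).2.2
          have hcard : ∀ x y, x ≠ y → x ∉ S → y ∉ S → (insert x (insert y S)).card = n := by
            intro x y hxy hx hy
            rw [Finset.card_insert_of_notMem (by simp [hxy, hx]), Finset.card_insert_of_notMem hy]
            omega
          have hlow : ∀ x y z, z < k → z ∈ insert x (insert y S) := by
            intro x y z hz
            have : z ∈ S := (hmS z).2 ⟨by omega, by omega, hkI' z hz⟩
            simp [this]
          have hpiv : ∀ y, k ≠ y → y ∉ S → PosMinor W (insert k (insert y S)) := by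
            intro y hy hyS
            refine ih _ (hcard k y hy hkS hyS) fun z hz => ?_
            rcases (Nat.lt_succ_iff_lt_or_eq.1 (Finset.mem_range.1 hz)) with hz | rfl
            · exact hlow k y z hz
            · simp
          rw [hIS]
          refine posMinor_of_plucker W S hcardS hka (q := m) (by omega) (by omega) hkS haS hmmS hbS
            (hpiv a (by omega) haS) (hpiv m (by omega) hmmS) (hpiv (a + d) (by omega) hbS) ?_ ?_
          · refine ihd a hka _ (hcard a m hma.symm haS hmmS)
              (fun z hz => hlow _ _ z (Finset.mem_range.1 hz)) fun x hx => ?_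
            simp only [Finset.mem_insert, hmS] at hx
            simp only [Finset.mem_union, Finset.mem_range, Finset.mem_Ico]
            rcases hx with rfl | rfl | hx
            · omega
            · omega
            · have := hsub' x hx.2.2
              omega
          · refine ihd (a + 1) (by omega) _ (hcard m (a + d) hmd hmmS hbS)
              (fun z hz => hlow _ _ z (Finset.mem_range.1 hz)) fun x hx => ?_
            simp only [Finset.mem_insert, hmS] at hx
            simp only [Finset.mem_union, Finset.mem_range, Finset.mem_Ico]
            rcases hx with rfl | rfl | hx
            · omega
            · omega
            · have := hsub' x hx.2.2
              omega
    intro I hI hsub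
    by_cases hkI : k ∈ I
    · refine ih I hI fun z hz => ?_
      rcases (Nat.lt_succ_iff_lt_or_eq.1 (Finset.mem_range.1 hz)) with hz | rfl
      · exact hsub (Finset.mem_range.2 hz)
      · exact hkI
    · refine hstep (I.sup id) (k + 1) (by omega) I hI hsub fun x hx => ?_
      have hx1 : x ≤ I.sup id := Finset.le_sup (f := id) hx
      have hx2 : x ≠ k := fun h => hkI (h ▸ hx)
      simp only [Finset.mem_union, Finset.mem_range, Finset.mem_Ico]
      omega

/-! ### Sign changes of sequences -/

/-- A nonzero entry `v p` followed by `n` positions at which consecutive entries change sign starts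
an alternating subsequence of length `n + 1`: one of the two entries at the next sign change is
opposite to the last entry chosen. -/
theorem exists_alternating_of_signChanges {v : ℕ → ℝ} (n p : ℕ) (hp : v p ≠ 0) (T : Finset ℕ)
    (hcard : T.card = n) (hT : ∀ t ∈ T, p ≤ t ∧ v t * v (t + 1) < 0) :
    ∃ i : Fin (n + 1) → ℕ, i 0 = p ∧
      ∀ j : Fin n, i j.castSucc < i j.succ ∧ v (i j.castSucc) * v (i j.succ) < 0 := by
  induction n generalizing p T with
  | zero => exact ⟨fun _ => p, rfl, fun j => j.elim0⟩
  | succ n ih =>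
    have hne : T.Nonempty := Finset.card_pos.1 (by omega)
    set t := T.min' hne with ht
    have htT : t ∈ T := T.min'_mem hne
    obtain ⟨hpt, hneg⟩ := hT t htT
    obtain ⟨q, hpq, hqt, hq⟩ : ∃ q, p < q ∧ q ≤ t + 1 ∧ v p * v q < 0 := by
      by_cases h : v p * v (t + 1) < 0
      · exact ⟨t + 1, by omega, le_rfl, h⟩
      · have h' : v p * v t < 0 := by
          rcases lt_or_gt_of_ne hp with hp | hp <;> rcases mul_neg_iff.1 hneg with ⟨h₁, h₂⟩ | ⟨h₁, h₂⟩
          · exact mul_neg_of_neg_of_pos hp h₁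
          · exact absurd (mul_neg_of_neg_of_pos hp h₂) h
          · exact absurd (mul_neg_of_pos_of_neg hp h₂) h
          · exact mul_neg_of_pos_of_neg hp h₁
        refine ⟨t, lt_of_le_of_ne hpt ?_, by omega, h'⟩
        rintro rfl
        exact absurd h' (mul_self_nonneg _).not_gt
    obtain ⟨i, hi0, hi⟩ := ih q (right_ne_zero_of_mul hq.ne) (T.erase t)
      (by rw [Finset.card_erase_of_mem htT, hcard]; rfl) (by
        intro x hx
        have hxT := Finset.mem_of_mem_erase hx
        have hlt : t < x := lt_of_le_of_ne (T.min'_le x hxT) (Finset.ne_of_mem_erase hx).symm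
        exact ⟨by omega, (hT x hxT).2⟩)
    refine ⟨Fin.cons p i, rfl, fun j => ?_⟩
    refine Fin.cases ?_ (fun j => ?_) j
    · simpa [hi0] using ⟨hpq, hq⟩
    · simpa [← Fin.succ_castSucc] using hi j

theorem exists_alternating_of_le_adjSignChanges {v : ℕ → ℝ} {n : ℕ}
    (h : (n : ℕ∞) ≤ adjSignChanges v) :
    ∃ i : Fin (n + 1) → ℕ, StrictMono i ∧ ∀ j : Fin n, v (i j.castSucc) * v (i j.succ) < 0 := by
  obtain ⟨s, hs, hcard⟩ := Set.exists_subset_encard_eq h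
  have hfin : s.Finite := Set.finite_of_encard_eq_coe hcard
  have hsucc : ∀ p ∈ s, p.2 = p.1 + 1 := fun p hp => (Order.succ_eq_of_covBy (hs hp).1).symm
  set T : Finset ℕ := hfin.toFinset.image Prod.fst with hTdef
  have hTcard : T.card = n := by
    rw [hTdef, Finset.card_image_of_injOn]
    · rw [hfin.encard_eq_coe_toFinset_card] at hcard
      exact_mod_cast hcard
    · intro p hp q hq hpq
      have hp' := hsucc p (by simpa using hp)
      have hq' := hsucc q (by simpa using hq)
      exact Prod.ext hpq (by rw [hp', hq', hpq])
  have hT : ∀ t ∈ T, v t * v (t + 1) < 0 := by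
    intro t ht
    obtain ⟨p, hp, rfl⟩ := Finset.mem_image.1 ht
    rw [← hsucc p (by simpa using hp)]
    exact (hs (by simpa using hp)).2
  rcases T.eq_empty_or_nonempty with hE | hne
  · obtain rfl : n = 0 := by rw [← hTcard, hE, Finset.card_empty]
    exact ⟨fun _ => 0, Fin.strictMono_iff_lt_succ.2 fun j => j.elim0, fun j => j.elim0⟩
  · obtain ⟨i, -, hi⟩ := exists_alternating_of_signChanges n (T.min' hne)
      (left_ne_zero_of_mul (hT _ (T.min'_mem hne)).ne) T hTcard
      fun t ht => ⟨T.min'_le t ht, hT t ht⟩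
    exact ⟨i, Fin.strictMono_iff_lt_succ.2 fun j => (hi j).1, fun j => (hi j).2⟩

theorem exists_signChange_between {v : ℕ → ℝ} (hv : ∀ t, v t ≠ 0) {a b : ℕ} (hab : a ≤ b)
    (h : v a * v b < 0) : ∃ t, a ≤ t ∧ t < b ∧ v t * v (t + 1) < 0 := by
  induction b, hab using Nat.le_induction with
  | base => exact absurd h (mul_self_nonneg _).not_gt
  | succ b hab ih =>
    by_cases hb : v a * v b < 0
    · obtain ⟨t, h₁, h₂, h₃⟩ := ih hb
      exact ⟨t, h₁, by omega, h₃⟩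
    · refine ⟨b, hab, by omega, ?_⟩
      have hb' : 0 < v a * v b := lt_of_le_of_ne (not_lt.1 hb) (mul_ne_zero (hv a) (hv b)).symm
      have : v a ^ 2 * (v b * v (b + 1)) < 0 := by
        have := mul_neg_of_pos_of_neg hb' h
        linarith
      exact (mul_neg_iff.1 this).elim (fun h => h.2) fun h => absurd h.1 (sq_nonneg _).not_gt

theorem le_adjSignChanges_of_alternating {v : ℕ → ℝ} (hv : ∀ t, v t ≠ 0) {n : ℕ}
    {i : Fin (n + 1) → ℕ} (hi : StrictMono i)
    (halt : ∀ j : Fin n, v (i j.castSucc) * v (i j.succ) < 0) :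
    (n : ℕ∞) ≤ adjSignChanges v := by
  have hex := fun j : Fin n =>
    exists_signChange_between hv (hi (Fin.castSucc_lt_succ (i := j))).le (halt j)
  choose t ht₁ ht₂ ht₃ using hex
  have hmono : StrictMono t := by
    intro j k hjk
    exact (ht₂ j).trans_le ((hi.monotone (Fin.succ_le_castSucc_iff.2 hjk)).trans (ht₁ k))
  have hinj : Function.Injective fun j => (t j, t j + 1) :=
    fun j k hjk => hmono.injective (Prod.ext_iff.1 hjk).1
  have hr : (n : ℕ∞) ≤ (Set.range fun j => (t j, t j + 1)).encard := by
    simpa using hinj.encard_range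
  refine hr.trans (Set.encard_le_encard ?_)
  rintro _ ⟨j, rfl⟩
  exact ⟨Order.covBy_add_one (t j), ht₃ j⟩

/-- A sequence whose entries alternate weakly in sign along `n + 1` indices can be made to have `n`
sign changes by a suitable replacement of its zeros. -/
theorem le_variPlus_of_weakly_alternating {u : ℕ → ℝ} {n : ℕ} {i : Fin (n + 1) → ℕ}
    (hi : StrictMono i) {ε : ℝ} (hε : ε ≠ 0)
    (h : ∀ j : Fin (n + 1), 0 ≤ (-1) ^ (j : ℕ) * ε * u (i j)) : (n : ℕ∞) ≤ variPlus u := by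
  classical
  -- Zeros on the chosen indices get the alternating sign; the value `1` at the remaining zeros
  -- only serves to make `v` vanish nowhere, so that a change of sign between two indices occurs at
  -- adjacent entries.
  set v : ℕ → ℝ := fun t =>
    if u t ≠ 0 then u t else Function.extend i (fun j => (-1) ^ (j : ℕ) * ε) 1 t with hvdef
  have hpow : ∀ j : ℕ, (-1 : ℝ) ^ j * ε ≠ 0 := fun j => mul_ne_zero (by simp) hε
  have hv0 : ∀ t, v t ≠ 0 := by
    intro t
    simp only [hvdef]
    split_ifs with ht
    · exact ht
    · by_cases hr : ∃ j, i j = t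
      · obtain ⟨j, rfl⟩ := hr
        rw [hi.injective.extend_apply]
        exact hpow j
      · rw [Function.extend_apply' _ _ _ hr]
        exact one_ne_zero
  have hpos : ∀ j : Fin (n + 1), 0 < (-1) ^ (j : ℕ) * ε * v (i j) := by
    intro j
    refine lt_of_le_of_ne ?_ (mul_ne_zero (hpow j) (hv0 _)).symm
    simp only [hvdef]
    split_ifs with ht
    · exact h j
    · rw [hi.injective.extend_apply]
      exact mul_self_nonneg _
  have halt : ∀ j : Fin n, v (i j.castSucc) * v (i j.succ) < 0 := by
    intro j
    have h₁ := mul_pos (hpos j.castSucc) (hpos j.succ)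
    rw [Fin.val_castSucc, Fin.val_succ] at h₁
    have h₂ : (-1 : ℝ) ^ (j : ℕ) * (-1) ^ (j : ℕ) = 1 := by
      rw [← mul_pow]; simp
    have h₃ : 0 < -(ε ^ 2 * (v (i j.castSucc) * v (i j.succ))) := by
      have e : (-1 : ℝ) ^ (j : ℕ) * ε * v (i j.castSucc) *
          ((-1) ^ ((j : ℕ) + 1) * ε * v (i j.succ)) =
          -(ε ^ 2 * (v (i j.castSucc) * v (i j.succ))) := by
        rw [pow_succ]
        linear_combination (-(ε ^ 2 * (v (i j.castSucc) * v (i j.succ)))) * h₂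
      rwa [e] at h₁
    by_contra hcon
    have := mul_nonneg (sq_nonneg ε) (not_lt.1 hcon)
    linarith
  refine (le_adjSignChanges_of_alternating hv0 hi halt).trans ?_
  refine le_iSup₂_of_le v ?_ le_rfl
  intro t ht
  simp [hvdef, ht]

/-! ### Sign variation in the column space and signs of maximal minors -/

/-- Laplace expansion of the vanishing determinant with columns `W x` and those of `W`, on the
`n + 1` rows `g`. -/
theorem sum_alternating_mul_minor {n : ℕ} (W : Matrix ℕ (Fin n) ℝ) (x : Fin n → ℝ)
    (g : Fin (n + 1) → ℕ) :
    ∑ j : Fin (n + 1), (-1) ^ (j : ℕ) * (W *ᵥ x) (g j) *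
      (W.submatrix (g ∘ j.succAbove) id).det = 0 := by
  set B : Matrix (Fin (n + 1)) (Fin (n + 1)) ℝ :=
    Matrix.of fun j => Fin.cons ((W *ᵥ x) (g j)) fun k => W (g j) k with hB
  have hdet : B.det = 0 := by
    rw [← Matrix.exists_mulVec_eq_zero_iff]
    refine ⟨Fin.cons (-1) x, fun h => ?_, ?_⟩
    · have := congrFun h 0
      simp at this
    · ext j
      simp [hB, Matrix.mulVec, dotProduct, Fin.sum_univ_succ]
  rw [← hdet, Matrix.det_succ_column_zero]
  rfl

/-- The easy half of the Gantmacher–Krein theorem: if the maximal minors are positive, then an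
element of the column space with `n` weak sign changes would make all terms of the expansion
`sum_alternating_mul_minor` of one sign, and hence vanish at `n` rows. -/
theorem variPlus_mulVec_le {n : ℕ} (hn : 1 ≤ n) (W : Matrix ℕ (Fin n) ℝ)
    (hW : ∀ f : Fin n → ℕ, StrictMono f → 0 < (W.submatrix f id).det) (x : Fin n → ℝ)
    (hx : x ≠ 0) : variPlus (W *ᵥ x) ≤ ((n - 1 : ℕ) : ℕ∞) := by
  refine iSup₂_le fun v hv => ?_
  by_contra! hlt
  have hle : (n : ℕ∞) ≤ adjSignChanges v := by
    have := Order.add_one_le_of_lt hlt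
    have e : ((n - 1 : ℕ) : ℕ∞) + 1 = n := by exact_mod_cast Nat.sub_add_cancel hn
    rwa [e] at this
  obtain ⟨g, hg, halt⟩ := exists_alternating_of_le_adjSignChanges hle
  have hv0 : v (g 0) ≠ 0 := by
    have := halt ⟨0, hn⟩
    exact left_ne_zero_of_mul this.ne
  have hsign : ∀ j : Fin (n + 1), 0 < (-1) ^ (j : ℕ) * v (g 0) * v (g j) := by
    intro j
    induction j using Fin.induction with
    | zero => simpa using mul_self_pos.2 hv0
    | succ j ih =>
      rw [Fin.val_castSucc] at ih
      rw [Fin.val_succ, pow_succ]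
      have h₁ := mul_neg_of_pos_of_neg ih (halt j)
      have h₂ : 0 < v (g j.castSucc) ^ 2 := sq_pos_of_ne_zero (left_ne_zero_of_mul (halt j).ne)
      refine (mul_pos_iff_of_pos_left h₂).1 ?_
      linarith
  have hterm : ∀ j : Fin (n + 1), 0 ≤ v (g 0) * ((-1) ^ (j : ℕ) * (W *ᵥ x) (g j) *
      (W.submatrix (g ∘ j.succAbove) id).det) := by
    intro j
    have hD := hW _ (hg.comp (Fin.strictMono_succAbove j))
    by_cases h0 : (W *ᵥ x) (g j) = 0
    · simp [h0]
    · have := mul_pos (hsign j) hD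
      rw [hv _ h0] at this
      linarith
  have hsum := sum_alternating_mul_minor W x g
  have hzero : ∀ j, (W *ᵥ x) (g j) = 0 := by
    intro j
    have h := (Finset.sum_eq_zero_iff_of_nonneg (fun j _ => hterm j)).1
      (by rw [← Finset.mul_sum, hsum, mul_zero]) j (Finset.mem_univ j)
    have hD := hW _ (hg.comp (Fin.strictMono_succAbove j))
    simpa [hv0, hD.ne'] using h
  have h0 := hW _ (hg.comp (Fin.strictMono_succAbove 0))
  refine hx (Matrix.eq_zero_of_mulVec_eq_zero h0.ne' ?_)
  ext k
  exact hzero _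

/-- If no nonzero element of the column space has `n` weak sign changes, then the `n + 1` maximal
minors of `n + 1` given rows are nonzero and of the same sign. If a minor vanished, there would be
an element with `n` zeros; if two neighbouring ones had opposite signs, the element vanishing on all
but the two rows concerned would alternate weakly. -/
theorem minor_mul_minor_pos {n : ℕ} (hn : 1 ≤ n) (W : Matrix ℕ (Fin n) ℝ)
    (hW : ∀ x : Fin n → ℝ, x ≠ 0 → variPlus (W *ᵥ x) ≤ ((n - 1 : ℕ) : ℕ∞))
    {g : Fin (n + 1) → ℕ} (hg : StrictMono g) (j : Fin (n + 1)) :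
    0 < (W.submatrix (g ∘ Fin.succAbove 0) id).det *
      (W.submatrix (g ∘ j.succAbove) id).det := by
  have hL : ∀ x : Fin n → ℝ, x ≠ 0 → ∀ ε : ℝ, ε ≠ 0 →
      (∀ j : Fin (n + 1), 0 ≤ (-1) ^ (j : ℕ) * ε * (W *ᵥ x) (g j)) → False := by
    intro x hx ε hε h
    have h₁ : n ≤ n - 1 := by
      exact_mod_cast (le_variPlus_of_weakly_alternating hg hε h).trans (hW x hx)
    omega
  set D : Fin (n + 1) → ℝ := fun j => (W.submatrix (g ∘ j.succAbove) id).det with hD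
  have hDne : ∀ j, D j ≠ 0 := by
    intro j h0
    obtain ⟨x, hx, hx0⟩ := Matrix.exists_mulVec_eq_zero_iff.2 h0
    have hzero : ∀ i, i ≠ j → (W *ᵥ x) (g i) = 0 := by
      intro i hij
      obtain ⟨k, rfl⟩ := Fin.exists_succAbove_eq hij
      exact congrFun hx0 k
    by_cases hj : (W *ᵥ x) (g j) = 0
    · refine hL x hx 1 one_ne_zero fun i => ?_
      by_cases hij : i = j
      · rw [hij, hj, mul_zero]
      · rw [hzero i hij, mul_zero]
    · refine hL x hx ((-1) ^ (j : ℕ) * (W *ᵥ x) (g j)) (mul_ne_zero (by simp) hj) fun i => ?_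
      by_cases hij : i = j
      · rw [hij]
        have h₂ : (-1 : ℝ) ^ (j : ℕ) * (-1) ^ (j : ℕ) = 1 := by
          rw [← mul_pow]; simp
        rw [← mul_assoc, h₂, one_mul]
        exact mul_self_nonneg _
      · rw [hzero i hij, mul_zero]
  have hstep : ∀ j : Fin n, 0 < D j.castSucc * D j.succ := by
    intro j
    by_contra hcon
    have hneg : D j.castSucc * D j.succ < 0 :=
      lt_of_le_of_ne (not_lt.1 hcon) (mul_ne_zero (hDne _) (hDne _))
    set B := W.submatrix (g ∘ j.castSucc.succAbove) id with hB
    have hBu : IsUnit B.det := isUnit_iff_ne_zero.2 (hDne j.castSucc)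
    set x := B⁻¹ *ᵥ Pi.single j (1 : ℝ) with hx
    have hBx : ∀ k, (W *ᵥ x) (g (j.castSucc.succAbove k)) = (Pi.single j (1 : ℝ) : Fin n → ℝ) k := by
      intro k
      have : B *ᵥ x = Pi.single j 1 := by
        rw [hx, Matrix.mulVec_mulVec, Matrix.mul_nonsing_inv B hBu, Matrix.one_mulVec]
      exact congrFun this k
    have hone : (W *ᵥ x) (g j.succ) = 1 := by
      have := hBx j
      rwa [Fin.succAbove_castSucc_self, Pi.single_eq_same] at this
    have hzero : ∀ i, i ≠ j.castSucc → i ≠ j.succ → (W *ᵥ x) (g i) = 0 := by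
      intro i h₁ h₂
      obtain ⟨k, rfl⟩ := Fin.exists_succAbove_eq h₁
      rw [hBx, Pi.single_eq_of_ne]
      rintro rfl
      exact h₂ (Fin.succAbove_castSucc_self _)
    have hx0 : x ≠ 0 := by
      intro h
      rw [h] at hone
      simp at hone
    have hrel := sum_alternating_mul_minor W x g
    rw [Finset.sum_eq_add_of_mem j.castSucc j.succ (Finset.mem_univ _) (Finset.mem_univ _)
      (Fin.castSucc_lt_succ).ne (fun i _ hi => by rw [hzero i hi.1 hi.2]; simp), hone,
      Fin.val_castSucc, Fin.val_succ] at hrel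
    have hrel' : (W *ᵥ x) (g j.castSucc) * D j.castSucc = D j.succ := by
      have h₂ : (-1 : ℝ) ^ (j : ℕ) * (-1) ^ (j : ℕ) = 1 := by
        rw [← mul_pow]; simp
      rw [pow_succ] at hrel
      simp only [hD]
      linear_combination (-1) ^ (j : ℕ) * hrel -
        ((W *ᵥ x) (g j.castSucc) * D j.castSucc - D j.succ) * h₂
    have huneg : (W *ᵥ x) (g j.castSucc) < 0 := by
      rw [← hrel'] at hneg
      by_contra hu
      have := mul_nonneg (not_lt.1 hu) (sq_nonneg (D j.castSucc))
      linarith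
    refine hL x hx0 (-(-1) ^ (j : ℕ)) (by simp) fun i => ?_
    have h₂ : (-1 : ℝ) ^ (j : ℕ) * (-1) ^ (j : ℕ) = 1 := by
      rw [← mul_pow]; simp
    by_cases h₁ : i = j.castSucc
    · rw [h₁, Fin.val_castSucc, mul_neg, h₂]
      linarith
    by_cases h₃ : i = j.succ
    · rw [h₃, Fin.val_succ, hone, pow_succ]
      linarith
    · rw [hzero i h₁ h₃, mul_zero]
  induction j using Fin.induction with
  | zero => exact mul_self_pos.2 (hDne 0)
  | succ j ih =>
    have h := mul_pos ih (hstep j)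
    refine (mul_pos_iff_of_pos_left (sq_pos_of_ne_zero (hDne j.castSucc))).1 ?_
    have e : D j.castSucc ^ 2 * (D 0 * D j.succ) =
      D 0 * D j.castSucc * (D j.castSucc * D j.succ) := by ring
    exact e ▸ h

/-- The increasing enumeration of `{0, …, k - 1} ∪ {s, s + 1, …}`, when `k ≤ s`. -/
def initialThenInterval (k s i : ℕ) : ℕ := if i < k then i else s + (i - k)

theorem strictMono_initialThenInterval {k s : ℕ} (h : k ≤ s) :
    StrictMono (initialThenInterval k s) := by
  intro i j hij
  simp only [initialThenInterval]
  split_ifs <;> omega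

/-- The minors with row set `{0, …, k - 1} ∪ {s, …, s + (n - k) - 1}` all have the sign of the
minor on the first `n` rows: the windows for `s` and `s + 1` lie in a common set of `n + 1` rows. -/
theorem minor_initialThenInterval_pos {n : ℕ} (hn : 1 ≤ n) (W : Matrix ℕ (Fin n) ℝ)
    (hW : ∀ x : Fin n → ℝ, x ≠ 0 → variPlus (W *ᵥ x) ≤ ((n - 1 : ℕ) : ℕ∞))
    (h0 : 0 < (W.submatrix (fun i : Fin n => (i : ℕ)) id).det) {k s : ℕ} (hk : k < n)
    (hks : k ≤ s) :
    0 < (W.submatrix (fun i : Fin n => initialThenInterval k s i) id).det := by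
  induction s, hks using Nat.le_induction with
  | base =>
    have e : (fun i : Fin n => initialThenInterval k k i) = fun i : Fin n => (i : ℕ) := by
      funext i
      simp only [initialThenInterval]
      split_ifs <;> omega
    rwa [e]
  | succ s hks ih =>
    set g : Fin (n + 1) → ℕ := fun i => initialThenInterval k s i with hgdef
    have hg : StrictMono g := fun i j hij => strictMono_initialThenInterval hks hij
    have e₁ : g ∘ (Fin.last n).succAbove = fun i : Fin n => initialThenInterval k s i := by
      funext i
      simp [hgdef]
    have e₂ : g ∘ (⟨k, by omega⟩ : Fin (n + 1)).succAbove =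
        fun i : Fin n => initialThenInterval k (s + 1) i := by
      funext i
      simp only [hgdef, Function.comp, Fin.succAbove, Fin.lt_def, Fin.val_castSucc,
        initialThenInterval]
      split_ifs <;> simp_all <;> omega
    have h₁ := minor_mul_minor_pos hn W hW hg (Fin.last n)
    have h₂ := minor_mul_minor_pos hn W hW hg ⟨k, by omega⟩
    rw [e₁] at h₁
    rw [e₂] at h₂
    have h₃ := (pos_iff_pos_of_mul_pos h₁).2 ih
    exact (mul_pos_iff_of_pos_left h₃).1 h₂

/-! ### The observability operator -/

theorem variMinus_le {n : ℕ} (u : Fin n → ℝ) : variMinus u ≤ ((n - 1 : ℕ) : EReal) := by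
  rw [variMinus]
  split_ifs with hu
  · have h₀ : ((0 : ℕ) : EReal) ≤ ((n - 1 : ℕ) : EReal) := by exact_mod_cast Nat.zero_le _
    rw [Nat.cast_zero] at h₀
    exact (by norm_num : (-1 : EReal) ≤ 0).trans h₀
  have hn : 0 < n := by
    rcases Nat.eq_zero_or_pos n with rfl | h
    · exact absurd (Subsingleton.elim u 0) hu
    · exact h
  have h : adjSignChanges (fun i : {i : Fin n // u i ≠ 0} => u i) ≤ ((n - 1 : ℕ) : ℕ∞) := by
    rw [adjSignChanges]
    -- A sign change is determined by its right end, which is never the first index.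
    have hmaps : ({p : {i : Fin n // u i ≠ 0} × {i : Fin n // u i ≠ 0} |
        p.1 ⋖ p.2 ∧ u p.1 * u p.2 < 0}).encard ≤ ({⟨0, hn⟩}ᶜ : Set (Fin n)).encard := by
      refine Set.encard_le_encard_of_injOn (f := fun p => (p.2 : Fin n)) ?_ ?_
      · rintro p ⟨hp, -⟩ h0
        have h₁ : (p.1 : Fin n) < p.2 := hp.lt
        have h₂ : (p.2 : Fin n) = ⟨0, hn⟩ := h0
        rw [h₂] at h₁
        exact absurd h₁ (by simp [Fin.lt_def])
      · rintro ⟨p, q⟩ ⟨hp, -⟩ ⟨p', q'⟩ ⟨hp', -⟩ h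
        obtain rfl : q = q' := Subtype.ext h
        exact Prod.ext (hp.unique_left hp') rfl
    refine hmaps.trans ?_
    rw [Set.encard_eq_coe_toFinset_card]
    simp [Finset.card_compl]
  have h' : ((adjSignChanges (fun i : {i : Fin n // u i ≠ 0} => u i) : ℕ∞) : ENNReal) ≤
      ((n - 1 : ℕ) : ENNReal) := by
    exact_mod_cast ENat.toENNReal_le.2 h
  have h'' := EReal.coe_ennreal_le_coe_ennreal_iff.2 h'
  have e : (((n - 1 : ℕ) : ENNReal) : EReal) = ((n - 1 : ℕ) : EReal) :=
    rfl
  rwa [e] at h''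

/-- By the Cayley–Hamilton theorem a state producing `n` zero outputs produces only zero
outputs. -/
theorem isUnit_det_obsMatrix {n : ℕ} {A : Matrix (Fin n) (Fin n) ℝ} {c : Fin n → ℝ}
    (hobs : Observable A c) : IsUnit (obsMatrix A c n).det := by
  rw [isUnit_iff_ne_zero]
  intro h
  obtain ⟨x, hx, hx0⟩ := Matrix.exists_mulVec_eq_zero_iff.2 h
  have hlow : ∀ t < n, c ⬝ᵥ (A ^ t *ᵥ x) = 0 := by
    intro t ht
    have := congrFun hx0 ⟨t, ht⟩
    rwa [Matrix.dotProduct_mulVec]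
  refine hx (hobs ?_)
  rw [map_zero]
  funext t
  change c ⬝ᵥ (A ^ t *ᵥ x) = 0
  have hdeg : (Polynomial.X ^ t %ₘ A.charpoly).natDegree < n ∨
      Polynomial.X ^ t %ₘ A.charpoly = 0 := by
    by_cases h0 : Polynomial.X ^ t %ₘ A.charpoly = 0
    · exact Or.inr h0
    · left
      have h₁ := Polynomial.degree_modByMonic_lt (Polynomial.X ^ t) A.charpoly_monic
      have h₂ := Polynomial.natDegree_lt_natDegree h0 h₁
      rwa [Matrix.charpoly_natDegree_eq_dim, Fintype.card_fin] at h₂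
  rw [Matrix.pow_eq_aeval_mod_charpoly]
  rcases hdeg with hdeg | h0
  · rw [Polynomial.aeval_eq_sum_range' hdeg, Matrix.sum_mulVec, dotProduct_sum]
    refine Finset.sum_eq_zero fun i hi => ?_
    rw [Matrix.smul_mulVec, dotProduct_smul, hlow i (Finset.mem_range.1 hi), smul_zero]
  · simp [h0]

/-- The matrix of the observability operator in the coordinates given by the first `n` outputs:
its rows are `c Aᵗ (𝒪ⁿ)⁻¹`, `t ≥ 0`, so that its first `n` rows form the identity. -/
noncomputable def outputMatrix {n : ℕ} (A : Matrix (Fin n) (Fin n) ℝ) (c : Fin n → ℝ) :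
    Matrix ℕ (Fin n) ℝ :=
  Matrix.of fun t => c ᵥ* A ^ t ᵥ* (obsMatrix A c n)⁻¹

theorem outputMatrix_mulVec {n : ℕ} (A : Matrix (Fin n) (Fin n) ℝ) (c y : Fin n → ℝ) :
    outputMatrix A c *ᵥ y = obsOperator A c ((obsMatrix A c n)⁻¹ *ᵥ y) := by
  funext t
  change (c ᵥ* A ^ t ᵥ* (obsMatrix A c n)⁻¹) ⬝ᵥ y = c ⬝ᵥ (A ^ t *ᵥ ((obsMatrix A c n)⁻¹ *ᵥ y))
  rw [← Matrix.dotProduct_mulVec, ← Matrix.dotProduct_mulVec]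

theorem outputMatrix_apply_lt {n : ℕ} {A : Matrix (Fin n) (Fin n) ℝ} {c : Fin n → ℝ}
    (hu : IsUnit (obsMatrix A c n).det) (i j : Fin n) :
    outputMatrix A c i j = (1 : Matrix (Fin n) (Fin n) ℝ) i j := by
  rw [← Matrix.mul_nonsing_inv _ hu]
  rfl

theorem strictlyVariationBounding_obsOperator_iff {n : ℕ} {A : Matrix (Fin n) (Fin n) ℝ}
    {c : Fin n → ℝ} (hu : IsUnit (obsMatrix A c n).det) :
    StrictlyVariationBounding (n - 1) (obsOperator A c) ↔
      ∀ y : Fin n → ℝ, y ≠ 0 → variPlus (outputMatrix A c *ᵥ y) ≤ ((n - 1 : ℕ) : ℕ∞) := by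
  constructor
  · intro h y hy
    rw [outputMatrix_mulVec]
    refine h _ (fun h0 => hy ?_) (variMinus_le _)
    have := congrArg (obsMatrix A c n *ᵥ ·) h0
    simpa [Matrix.mulVec_mulVec, Matrix.mul_nonsing_inv _ hu] using this
  · intro h x hx _
    have hy := h (obsMatrix A c n *ᵥ x) fun h0 => hx ?_
    · rwa [outputMatrix_mulVec, Matrix.mulVec_mulVec, Matrix.nonsing_inv_mul _ hu,
        Matrix.one_mulVec] at hy
    · exact Matrix.eq_zero_of_mulVec_eq_zero hu.ne_zero h0

/-- The impulse response of the `r`-th compound system at time `t + 1` is the maximal minor of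
`outputMatrix` with rows `0, …, n - r - 1` followed by `r` consecutive rows from `n - r + t` on.
As the former are unit vectors, this minor is block triangular. -/
theorem impulseResponse_eq_minor {n : ℕ} {A : Matrix (Fin n) (Fin n) ℝ} {c : Fin n → ℝ}
    (hu : IsUnit (obsMatrix A c n).det) {r : ℕ} (hr : r ≤ n) (t : ℕ) :
    cTilde A c r ⬝ᵥ (compound A r ^ t *ᵥ bTilde A c r) =
      ((outputMatrix A c).submatrix
        (fun i : Fin n => initialThenInterval (n - r) (n - r + t) i) id).det := by
  rw [cTilde_dotProduct_pow_mulVec_bTilde]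
  obtain ⟨k, rfl⟩ := Nat.exists_eq_add_of_le' hr
  rw [Nat.add_sub_cancel]
  have hblock : ((outputMatrix A c).submatrix
      (fun i : Fin (k + r) => initialThenInterval k (k + t) i) id).submatrix
        finSumFinEquiv finSumFinEquiv =
      Matrix.fromBlocks 1 0
        (Matrix.of fun (i : Fin r) (j : Fin k) =>
          outputMatrix A c (k + t + i) (Fin.castAdd r j))
        (obsMatrix A c r *
          (A ^ t * (A ^ k * (obsMatrix A c (k + r))⁻¹ * zeroOverOne (k + r) r))) := by
    have hlow : ∀ (i : Fin k) (j : Fin (k + r)),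
        outputMatrix A c (initialThenInterval k (k + t) (Fin.castAdd r i)) j =
          (1 : Matrix (Fin (k + r)) (Fin (k + r)) ℝ) (Fin.castAdd r i) j := by
      intro i j
      rw [← outputMatrix_apply_lt hu]
      simp [initialThenInterval]
    have hhigh : ∀ i : Fin r, initialThenInterval k (k + t) (Fin.natAdd k i) = k + t + i := by
      intro i
      simp [initialThenInterval]
    ext i j
    rcases i with i | i <;> rcases j with j | j
    · simp only [Matrix.submatrix_apply, finSumFinEquiv_apply_left, id, hlow,
        Matrix.fromBlocks_apply₁₁, Matrix.one_apply, (Fin.castAdd_injective k r).eq_iff]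
    · simp only [Matrix.submatrix_apply, finSumFinEquiv_apply_left, finSumFinEquiv_apply_right, id,
        hlow, Matrix.fromBlocks_apply₁₂, Matrix.zero_apply]
      refine Matrix.one_apply_ne fun h => ?_
      have := congrArg Fin.val h
      simp at this
      omega
    · simp only [Matrix.submatrix_apply, finSumFinEquiv_apply_left, finSumFinEquiv_apply_right, id,
        hhigh, Matrix.fromBlocks_apply₂₁, Matrix.of_apply]
    · simp only [Matrix.submatrix_apply, finSumFinEquiv_apply_right, id,
        hhigh, Matrix.fromBlocks_apply₂₂]
      have hZ : ∀ w : Fin (k + r) → ℝ,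
          (w ᵥ* zeroOverOne (k + r) r) j = w (Fin.natAdd k j) := by
        intro w
        simp only [Matrix.vecMul, dotProduct, zeroOverOne, Matrix.of_apply]
        rw [Finset.sum_eq_single (Fin.natAdd k j)]
        · simp; omega
        · intro b _ hb
          rw [if_neg, mul_zero]
          intro h
          exact hb (Fin.ext (by simp; omega))
        · simp
      have hrow : (obsMatrix A c r *
          (A ^ t * (A ^ k * (obsMatrix A c (k + r))⁻¹ * zeroOverOne (k + r) r))) i =
          outputMatrix A c (k + t + i) ᵥ* zeroOverOne (k + r) r := by
        change (c ᵥ* A ^ (i : ℕ)) ᵥ* _ = (c ᵥ* A ^ (k + t + i) ᵥ* (obsMatrix A c (k + r))⁻¹) ᵥ* _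
        simp only [Matrix.vecMul_vecMul, ← Matrix.mul_assoc, ← pow_add]
        rw [show (i : ℕ) + (t + k) = k + t + i by omega]
      rw [hrow, hZ]
  rw [← Matrix.det_submatrix_equiv_self finSumFinEquiv
    ((outputMatrix A c).submatrix _ id), hblock, Matrix.det_fromBlocks_zero₁₂, Matrix.det_one,
    one_mul]

theorem range_initialThenInterval {n k s : ℕ} (hk : k ≤ n) :
    Set.range (fun i : Fin n => initialThenInterval k s i) =
      ((Finset.range k ∪ Finset.Ico s (s + (n - k)) : Finset ℕ) : Set ℕ) := by
  ext x
  simp only [Set.mem_range, initialThenInterval, Finset.coe_union, Finset.coe_range,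
    Finset.coe_Ico, Set.mem_union, Set.mem_Iio, Set.mem_Ico]
  constructor
  · rintro ⟨i, rfl⟩
    have := i.2
    split_ifs <;> omega
  · rintro (h | h)
    · exact ⟨⟨x, by omega⟩, by simp [h]⟩
    · refine ⟨⟨k + (x - s), by omega⟩, ?_⟩
      simp only [Nat.not_lt.2 (Nat.le_add_right _ _), if_false]
      omega

end VarBound

theorem theorem1 {n : ℕ} (hn : 1 ≤ n) (A : Matrix (Fin n) (Fin n) ℝ) (c : Fin n → ℝ)
    (hobs : Observable A c) :
    StrictlyVariationBounding (n - 1) (obsOperator A c) ↔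
      ∀ r : ℕ, 1 ≤ r → r ≤ n →
        StrictlyExternallyPositive (compound A r) (bTilde A c r) (cTilde A c r) := by
  have hu := isUnit_det_obsMatrix hobs
  rw [strictlyVariationBounding_obsOperator_iff hu]
  constructor
  · intro h r hr hrn t _
    rw [impulseResponse_eq_minor hu hrn]
    refine minor_initialThenInterval_pos hn _ h ?_ (by omega) (Nat.le_add_right _ _)
    have h1 : (outputMatrix A c).submatrix (fun i : Fin n => (i : ℕ)) id = 1 := by
      ext i j
      exact outputMatrix_apply_lt hu i j
    rw [h1, Matrix.det_one]
    exact one_pos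
  · intro h
    have hpos : ∀ k s, k < n → k ≤ s →
        PosMinor (outputMatrix A c) (Finset.range k ∪ Finset.Ico s (s + (n - k))) := by
      intro k s hk hks
      refine ⟨_, fun i j hij => strictMono_initialThenInterval hks hij,
        range_initialThenInterval hk.le, ?_⟩
      have := h (n - k) (by omega) (by omega) (s - k + 1) (by omega)
      rwa [Nat.add_sub_cancel, impulseResponse_eq_minor hu (by omega), Nat.sub_sub_self hk.le,
        Nat.add_sub_cancel' hks] at this
    refine variPlus_mulVec_le hn _ fun f hf => ?_
    have hI : Set.range f = (Finset.univ.image f : Finset ℕ) := by simp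
    have hcard : (Finset.univ.image f).card = n := by
      rw [Finset.card_image_of_injective _ hf.injective, Finset.card_fin]
    exact (orientedMinor_pos_iff _ hf).1 ((posMinor_iff _ hf.injective hI).1
      (posMinor_of_initial _ hn hpos _ hcard))
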